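/- Let $\alpha\in(0,1)$, $T>0$, $\eta\in\mathbb{R}^m$, fix any norm on $\mathbb{R}^m$ (with the induced operator norms), and let $f:[0,T]\times\mathbb{R}^m\to\mathbb{R}^m$. For initial values $\xi\in\mathbb{R}^m$ let $y(\cdot,\xi)$ be the solution on $[0,T]$ of the fractional initial value problem $$ D^\alpha y(t,\xi)=f(t,y(t,\xi)),\qquad y(0,\xi)=\xi, $$ and let $\Phi(\cdot,\xi)$, with values in $\mathbb{R}^{m\times m}$, be the solution on $[0,T]$ of the variational problem $$ D^\alpha \Phi(t,\xi)=f'(t,y(t,\xi))\,\Phi(t,\xi),\qquad \Phi(0,\xi)=I, $$ where $f'$ is the Jacobian of $f$ with respect to the state variable. Here $D^\alpha$ is the Caputo derivative: for a continuous function $u$, $D^\alpha u(t)=\frac{d}{dt}\frac{1}{\Gamma(1-\alpha)}\int_0^t (t-x)^{-\alpha}\,(u(x)-u(0))\,dx$, which for absolutely continuous $u$ is $\frac{1}{\Gamma(1-\alpha)}\int_0^t (t-x)^{-\alpha}u'(x)\,dx$. Let $\rho^*\in\mathbb{R}^m$ satisfy $y(T,\rho^*)=\eta$ and $\det\Phi(T,\rho^*)\neq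 0$. Assume that $y(\cdot,\xi)$ and $\Phi(\cdot,\xi)$ exist for all $\xi$ in a neighborhood of $\rho^*$, that $f$ is continuous and continuously differentiable in the state variable in a neighborhood (in $[0,T]\times\mathbb{R}^m$) of the trajectory $\{(t,y(t,\rho^*)):t\in[0,T]\}$, and that $\xi\mapsto\Phi(T,\xi)$ is continuously differentiable in a neighborhood of $\rho^*$, with derivative denoted by $\Phi'(T,\xi)$. Let $(\rho_\ell)_{\ell\ge 0}$ be a sequence generated by the shooting-Newton iteration $$ \rho_{\ell+1}=\rho_\ell-\Phi(T,\rho_\ell)^{-1}\,[\,y(T,\rho_\ell)-\eta\,],\qquad \ell=0,1,\dots, $$ where, for every $\ell$, $y(\cdot,\rho_\ell)$ and $\Phi(\cdot,\rho_\ell)$ exist and $\Phi(T,\rho_\ell)$ is invertible. If $\rho_\ell\to\rho^*$, then the convergence is quadratic: with $e_\ell=\rho^*-\rho_\ell$ one has $\|e_{\ell+1}\|=O(\|e_\ell\|^2)$ as $\ell\to\infty$, and $$ \limsup_{\ell\to\infty}\frac{\|e_{\ell+1}\|}{\|e_\ell\|^2}\;\le\;\frac12\,\|\Phi(T,\rho^*)^{-1}\|\,\|\Phi'(T,\rho^*)\|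 , $$ where a quotient $0/0$ is read as $0$ (and $a/0$ with $a>0$ as $+\infty$, so that in particular $e_{\ell+1}=0$ whenever $e_\ell=0$ and $\ell$ is large). -/

import Mathlib

open Set Filter Topology MeasureTheory Asymptotics
open scoped ENNReal

namespace FracShooting

variable {E F : Type*} [NormedAddCommGroup E] [NormedSpace ℝ E]
  [NormedAddCommGroup F] [NormedSpace ℝ F]

/-- The Riemann-Liouville integral of order `β`,
`I^β g (t) = (1 / Γ(β)) ∫₀ᵗ (t - x)^(β-1) g(x) dx`. -/
noncomputable def rlIntegral (β : ℝ) (g : ℝ → F) (t : ℝ) : F :=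
  (Real.Gamma β)⁻¹ • ∫ x in (0 : ℝ)..t, (t - x) ^ (β - 1) • g x

/-- `HasCaputoDeriv α T u h`: the function `u` is continuous on `[0,T]` and its Caputo derivative of
order `α ∈ (0,1)` exists on `[0,T]` and equals `h` there.  The Caputo derivative is taken in its
standard form `D^α u = d/dt I^(1-α) (u - u(0))` (one-sided derivatives at the end points), which
makes sense for functions `u` that are merely continuous.  For absolutely continuous `u` it is
the integral `(1 / Γ(1-α)) ∫₀ᵗ (t - x)^(-α) u'(x) dx`: see `hasCaputoDeriv_iff` below. -/
def HasCaputoDeriv (α T : ℝ) (u h : ℝ → F) : Prop :=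
  ContinuousOn u (Icc 0 T) ∧
    ∀ t ∈ Icc (0 : ℝ) T,
      HasDerivWithinAt (rlIntegral (1 - α) (fun s => u s - u 0)) (h t) (Icc 0 T) t

theorem integrable_kernel {β t : ℝ} (hβ : 0 < β) (ht : 0 ≤ t) :
    Integrable ((Ioc (0 : ℝ) t).indicator fun r : ℝ => r ^ (β - 1)) := by
  rw [integrable_indicator_iff measurableSet_Ioc]
  have h : IntervalIntegrable (fun r : ℝ => r ^ (β - 1)) volume 0 t :=
    intervalIntegral.intervalIntegrable_rpow' (by linarith)
  exact (intervalIntegrable_iff_integrableOn_Ioc_of_le ht).1 h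

/-- The integrand of the convolution of the kernel with `g`, cut off at `t`. -/
theorem conv_eq {β t s : ℝ} (hs : s ∈ Ioc (0 : ℝ) t) (g : ℝ → F) :
    ∫ r, (Ioc (0 : ℝ) t).indicator (fun r : ℝ => r ^ (β - 1)) r •
        (Ico (0 : ℝ) t).indicator g (s - r) =
      ∫ x in (0 : ℝ)..s, (s - x) ^ (β - 1) • g x := by
  have h1 : ∫ x in (0 : ℝ)..s, (s - x) ^ (β - 1) • g x =
      ∫ r in (0 : ℝ)..s, r ^ (β - 1) • g (s - r) := by
    have := intervalIntegral.integral_comp_sub_left (a := 0) (b := s)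
      (fun r : ℝ => r ^ (β - 1) • g (s - r)) s
    simpa using this
  rw [h1, intervalIntegral.integral_of_le hs.1.le, ← integral_indicator measurableSet_Ioc]
  congr 1
  ext r
  by_cases h : r ∈ Ioc 0 s
  · have h2 : r ∈ Ioc 0 t := ⟨h.1, h.2.trans hs.2⟩
    have h3 : s - r ∈ Ico 0 t := ⟨by linarith [h.2], by linarith [h.1, hs.2]⟩
    simp [h, h2, h3]
  · rw [indicator_of_notMem h]
    by_cases h2 : r ∈ Ioc 0 t
    · have h3 : s - r ∉ Ico 0 t := fun h3 => h ⟨h2.1, by linarith [h3.1]⟩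
      simp [h3]
    · simp [h2]

theorem conv_integrable {β t : ℝ} (hβ : 0 < β) (ht : 0 ≤ t) {g : ℝ → F}
    (hg : IntervalIntegrable g volume 0 t) :
    Integrable (fun p : ℝ × ℝ => (Ioc (0 : ℝ) t).indicator (fun r : ℝ => r ^ (β - 1)) p.2 •
        (Ico (0 : ℝ) t).indicator g (p.1 - p.2)) := by
  have hg' : Integrable ((Ico (0 : ℝ) t).indicator g) := by
    rw [integrable_indicator_iff measurableSet_Ico]
    exact (intervalIntegrable_iff_integrableOn_Ico_of_le ht).1 hg
  exact (integrable_kernel hβ ht).convolution_integrand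
    (ContinuousLinearMap.lsmul ℝ ℝ) hg'

theorem intervalIntegrable_rlIntegral {β t : ℝ} (hβ : 0 < β) (ht : 0 ≤ t) {g : ℝ → F}
    (hg : IntervalIntegrable g volume 0 t) :
    IntervalIntegrable (rlIntegral β g) volume 0 t := by
  rw [intervalIntegrable_iff_integrableOn_Ioc_of_le ht]
  have h : IntegrableOn _ (Ioc 0 t) := ((conv_integrable hβ ht hg).integral_prod_left.smul
    (Real.Gamma β)⁻¹).integrableOn
  refine IntegrableOn.congr_fun h (fun s hs => ?_) measurableSet_Ioc
  simp only [Pi.smul_apply, rlIntegral, conv_eq hs g]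

/-- `I^β I^1 g = I^1 I^β g`. -/
theorem rlIntegral_integral {β t : ℝ} (hβ : 0 < β) (ht : 0 ≤ t) {g : ℝ → F}
    (hg : IntervalIntegrable g volume 0 t) :
    rlIntegral β (fun s => ∫ x in (0 : ℝ)..s, g x) t = ∫ s in (0 : ℝ)..t, rlIntegral β g s := by
  simp only [rlIntegral, intervalIntegral.integral_smul]
  congr 1
  have hI := conv_integrable hβ ht hg
  have e1 : ∫ s in (0 : ℝ)..t, ∫ x in (0 : ℝ)..s, (s - x) ^ (β - 1) • g x =
      ∫ s in Ioc (0 : ℝ) t, ∫ r, (Ioc (0 : ℝ) t).indicator (fun r : ℝ => r ^ (β - 1)) r •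
        (Ico (0 : ℝ) t).indicator g (s - r) := by
    rw [intervalIntegral.integral_of_le ht]
    exact setIntegral_congr_fun measurableSet_Ioc fun s hs => (conv_eq hs g).symm
  have e2 : ∫ x in (0 : ℝ)..t, (t - x) ^ (β - 1) • ∫ x in (0 : ℝ)..x, g x =
      ∫ r in (0 : ℝ)..t, r ^ (β - 1) • ∫ x in (0 : ℝ)..(t - r), g x := by
    have := intervalIntegral.integral_comp_sub_left (a := 0) (b := t)
      (fun r : ℝ => r ^ (β - 1) • ∫ x in (0 : ℝ)..(t - r), g x) t
    simpa using this
  rw [e1, e2, integral_integral_swap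
    (hI.mono_measure (by
      exact Measure.prod_mono Measure.restrict_le_self le_rfl)),
    intervalIntegral.integral_of_le ht, ← integral_indicator measurableSet_Ioc]
  congr 1
  ext r
  by_cases h : r ∈ Ioc 0 t
  · simp only [indicator_of_mem h]
    rw [integral_smul]
    congr 1
    have hr : (0 : ℝ) ≤ t - r := by linarith [h.2]
    have e3 : ∫ x in (0 : ℝ)..(t - r), g x = ∫ s in r..t, g (s - r) := by
      rw [intervalIntegral.integral_comp_sub_right]; simp
    rw [e3, intervalIntegral.integral_of_le h.2, ← integral_indicator measurableSet_Ioc,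
      ← integral_indicator measurableSet_Ioc]
    apply integral_congr_ae
    have : ∀ᵐ s : ℝ, s ≠ r := by simp [ae_iff]
    filter_upwards [this] with s hsr
    by_cases hs : s ∈ Ioc r t
    · have h1 : s ∈ Ioc 0 t := ⟨h.1.trans hs.1, hs.2⟩
      have h2 : s - r ∈ Ico 0 t := ⟨by linarith [hs.1], by linarith [h.1, hs.2]⟩
      simp only [indicator_of_mem hs, indicator_of_mem h1, indicator_of_mem h2]
    · rw [indicator_of_notMem hs]
      by_cases h1 : s ∈ Ioc 0 t
      · have h2 : s - r ∉ Ico 0 t := fun h2 =>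
          hs ⟨lt_of_le_of_ne (by linarith [h2.1]) (Ne.symm hsr), h1.2⟩
        simp only [indicator_of_mem h1, indicator_of_notMem h2]
      · simp only [indicator_of_notMem h1]
  · simp [indicator_of_notMem h]

/-- For an absolutely continuous function `u` (the integral of its derivative) and a continuous
function `h`, `HasCaputoDeriv α T u h` says that
`(1 / Γ(1-α)) ∫₀ᵗ (t - x)^(-α) u'(x) dx = h(t)` for almost all `t ∈ [0,T]`. -/
theorem hasCaputoDeriv_iff [CompleteSpace F] {α T : ℝ} (hα1 : α < 1) (hT : 0 < T)
    {u h : ℝ → F} (hint : IntervalIntegrable (deriv u) volume 0 T)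
    (hu : ∀ t ∈ Icc (0 : ℝ) T, u t = u 0 + ∫ x in (0 : ℝ)..t, deriv u x)
    (hh : ContinuousOn h (Icc 0 T)) :
    HasCaputoDeriv α T u h ↔
      ∀ᵐ t, t ∈ Icc (0 : ℝ) T →
        (Real.Gamma (1 - α))⁻¹ • ∫ x in (0 : ℝ)..t, (t - x) ^ (-α) • deriv u x = h t := by
  have hβ : 0 < 1 - α := by linarith
  have e : 1 - α - 1 = -α := by ring
  have hF : ∀ t ∈ Icc (0 : ℝ) T, rlIntegral (1 - α) (fun s => u s - u 0) t =
      ∫ s in (0 : ℝ)..t, rlIntegral (1 - α) (deriv u) s := by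
    intro t ht
    have hint' : IntervalIntegrable (deriv u) volume 0 t :=
      hint.mono_set (by rw [uIcc_of_le ht.1, uIcc_of_le hT.le]; exact Icc_subset_Icc_right ht.2)
    rw [← rlIntegral_integral hβ ht.1 hint', rlIntegral, rlIntegral]
    congr 1
    refine intervalIntegral.integral_congr fun s hs => ?_
    rw [uIcc_of_le ht.1] at hs
    rw [hu s ⟨hs.1, hs.2.trans ht.2⟩, add_sub_cancel_left]
  have hII := intervalIntegrable_rlIntegral hβ hT.le hint
  have hcont : ContinuousOn u (Icc 0 T) := by
    have h1 := intervalIntegral.continuousOn_primitive_interval'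
      hint (left_mem_uIcc)
    rw [uIcc_of_le hT.le] at h1
    exact (continuousOn_const.add h1).congr hu
  constructor
  · rintro ⟨-, h2⟩
    filter_upwards [hII.ae_hasDerivAt_integral] with t hd ht
    have hd' := (hd (by rwa [uIcc_of_le hT.le]) 0 left_mem_uIcc).hasDerivWithinAt (s := Icc 0 T)
    have h3 := (h2 t ht).congr (fun s hs => (hF s hs).symm) (hF t ht).symm
    have := (uniqueDiffOn_Icc hT t ht).eq_deriv _ hd' h3
    simpa only [rlIntegral, e] using this
  · intro hae
    refine ⟨hcont, fun t ht => ?_⟩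
    have hc : Continuous (IccExtend hT.le ((Icc 0 T).domRestrict h)) :=
      (continuousOn_iff_continuous_domRestrict.1 hh).Icc_extend'
    have hd := (hc.integral_hasStrictDerivAt 0 t).hasDerivAt.hasDerivWithinAt (s := Icc 0 T)
    rw [IccExtend_of_mem _ _ ht] at hd
    have key : ∀ s ∈ Icc (0 : ℝ) T, rlIntegral (1 - α) (fun s => u s - u 0) s =
        ∫ x in (0 : ℝ)..s, IccExtend hT.le ((Icc 0 T).domRestrict h) x := by
      intro s hs
      rw [hF s hs]
      refine intervalIntegral.integral_congr_ae ?_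
      filter_upwards [hae] with x hx hxs
      rw [uIoc_of_le hs.1] at hxs
      have hxT : x ∈ Icc 0 T := ⟨hxs.1.le, hxs.2.trans hs.2⟩
      rw [IccExtend_of_mem _ _ hxT, domRestrict_apply, ← hx hxT, rlIntegral, e]
    exact hd.congr key (key t ht)

/-- `u` is a solution on `[0,T]` of the fractional initial value problem
`D^α u(t) = f(t, u(t))`, `u(0) = ξ`. -/
def IsIVPSolution (α T : ℝ) (f : ℝ → E → E) (ξ : E) (u : ℝ → E) : Prop :=
  u 0 = ξ ∧ HasCaputoDeriv α T u (fun t => f t (u t))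

/-- `P` is a solution on `[0,T]` of the fractional variational problem along `u`,
`D^α P(t) = f'(t, u(t)) P(t)`, `P(0) = I`, where `f'` is the Jacobian of `f` with respect to the
state variable. -/
def IsVariationalSolution (α T : ℝ) (f : ℝ → E → E) (u : ℝ → E) (P : ℝ → E →L[ℝ] E) : Prop :=
  (∀ t ∈ Icc (0 : ℝ) T, DifferentiableAt ℝ (f t) (u t)) ∧
    P 0 = ContinuousLinearMap.id ℝ E ∧
      HasCaputoDeriv α T P (fun t => (fderiv ℝ (f t) (u t)).comp (P t))

/-- On a neighbourhood of the trajectory `{(t, u(t)) : 0 ≤ t ≤ T}`, relative to `[0,T] × E`, the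
function `f` is continuous and continuously differentiable with respect to the state variable. -/
def IsC1NearTrajectory (T : ℝ) (f : ℝ → E → E) (u : ℝ → E) : Prop :=
  ∃ W : Set (ℝ × E), IsOpen W ∧ (∀ t ∈ Icc (0 : ℝ) T, (t, u t) ∈ W) ∧
    ContinuousOn (fun p : ℝ × E => f p.1 p.2) (W ∩ Icc (0 : ℝ) T ×ˢ univ) ∧
    (∀ p ∈ W ∩ Icc (0 : ℝ) T ×ˢ univ, DifferentiableAt ℝ (f p.1) p.2) ∧
    ContinuousOn (fun p : ℝ × E => fderiv ℝ (f p.1) p.2) (W ∩ Icc (0 : ℝ) T ×ˢ univ)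

/-- `ρ` is a sequence generated by the shooting-Newton procedure for the terminal value problem
`D^α y = f(t, y)`, `y(T) = η`: for every `l`, `y(·, ρ_l)` and `Φ(·, ρ_l)` solve the initial value
problem with initial value `ρ_l` and the associated variational problem, `Φ(T, ρ_l)` is
invertible, and `ρ_{l+1} = ρ_l - Φ(T, ρ_l)⁻¹ [y(T, ρ_l) - η]`. -/
structure IsShootingNewton (α T : ℝ) (f : ℝ → E → E) (η : E) (y : ℝ → E → E)
    (Φ : ℝ → E → E →L[ℝ] E) (ρ : ℕ → E) : Prop where
  solves : ∀ l, IsIVPSolution α T f (ρ l) (fun t => y t (ρ l))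
  variational : ∀ l, IsVariationalSolution α T f (fun t => y t (ρ l)) (fun t => Φ t (ρ l))
  det_ne_zero : ∀ l, (Φ T (ρ l)).det ≠ 0
  step : ∀ l, ρ (l + 1) = ρ l - (Φ T (ρ l)).inverse (y T (ρ l) - η)

end FracShooting

/-! The iteration is Newton's method for `g(ξ) = y(T, ξ) - η` as soon as `Φ(T, ξ)` is known to be
the derivative of `y(T, ·)` at every `ξ` near the root. This is `eventually_hasFDerivAt_terminal`;
the rest is `newton_quadratic`.

Differentiability: the semigroup law for fractional integrals turns a Caputo equation into the
Volterra equation `u = u(0) + I^α h` (`HasCaputoDeriv.volterra`), to which a Gronwall inequality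
with singular kernel applies (`exists_caputo_gronwall`). With a continuation argument it keeps
nearby trajectories in a compact tube and makes them Lipschitz in the initial value. The remainder
`y(t, ζ) - y(t, ξ) - Φ(t, ξ)(ζ - ξ)` starts at zero and solves the linearised equation up to a
Taylor error `o(‖ζ - ξ‖)`, so Gronwall makes it `o(‖ζ - ξ‖)` as well.

Newton: near the root the Jacobian `A` of `g` is Lipschitz with any constant `K > ‖A'‖`, so the
Taylor remainder is at most `K/2 ‖e‖²`. The new error is, up to sign, `A⁻¹` applied to that
remainder. Continuity of inversion and `K ↓ ‖A'‖` give the sharp constant. -/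

namespace FracShooting

/-! ### Fractional integrals and the Volterra form of Caputo equations. -/

/-- The Beta integral of the Abel kernels of complementary orders, on an arbitrary interval. -/
theorem integral_abel_kernel {α s t : ℝ} (hα0 : 0 < α) (hα1 : α < 1) (hst : s < t) :
    ∫ x in s..t, (t - x) ^ (α - 1) * (x - s) ^ (-α) = Real.Gamma α * Real.Gamma (1 - α) := by
  have hsub := intervalIntegral.integral_comp_sub_right (a := s) (b := t)
    (fun u : ℝ => (t - s - u) ^ (α - 1) * u ^ (-α)) s
  have e1 : ∀ x : ℝ, t - s - (x - s) = t - x := fun x => by ring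
  simp only [e1, sub_self] at hsub
  rw [hsub]
  have hpos : 0 < t - s := sub_pos.2 hst
  have hb := Complex.betaIntegral_scaled ((1 - α : ℝ) : ℂ) (α : ℂ) hpos
  have hg := Complex.Gamma_mul_Gamma_eq_betaIntegral (s := ((1 - α : ℝ) : ℂ)) (t := (α : ℂ))
    (by simpa using hα1) (by simpa using hα0)
  -- The orders add up to 1, so the power of `t - s` produced by rescaling has exponent 0 and the
  -- value does not depend on the interval.
  have e2 : ((1 - α : ℝ) : ℂ) + (α : ℂ) = 1 := by push_cast; ring
  rw [e2, Complex.Gamma_one, one_mul] at hg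
  rw [e2, sub_self, Complex.cpow_zero, one_mul, ← hg, Complex.Gamma_ofReal,
    Complex.Gamma_ofReal] at hb
  have hc : ((∫ u in (0 : ℝ)..(t - s), (t - s - u) ^ (α - 1) * u ^ (-α) : ℝ) : ℂ) =
      (Real.Gamma (1 - α) : ℂ) * (Real.Gamma α : ℂ) := by
    rw [← hb, ← intervalIntegral.integral_ofReal]
    refine intervalIntegral.integral_congr fun u hu => ?_
    rw [uIcc_of_le hpos.le] at hu
    have h1 : 0 ≤ t - s - u := by linarith [hu.2]
    simp only [Complex.ofReal_mul, Complex.ofReal_cpow hu.1, Complex.ofReal_cpow h1]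
    rw [mul_comm]
    push_cast
    congr 2
    ring
  rw [mul_comm (Real.Gamma α)]
  exact_mod_cast hc

section Vector

variable {F G : Type*} [NormedAddCommGroup F] [NormedSpace ℝ F]
  [NormedAddCommGroup G] [NormedSpace ℝ G]

theorem rlIntegral_zero_right (β : ℝ) (g : ℝ → F) : rlIntegral β g 0 = 0 := by
  simp [rlIntegral]

/-- The semigroup law `I^α I^(1-α) g = I^1 g`. -/
theorem rlIntegral_rlIntegral_compl [CompleteSpace F] {α t : ℝ} (hα0 : 0 < α) (hα1 : α < 1)
    (ht : 0 ≤ t) {g : ℝ → F} (hg : IntervalIntegrable g volume 0 t) :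
    rlIntegral α (rlIntegral (1 - α) g) t = ∫ x in (0 : ℝ)..t, g x := by
  have hB : Real.Gamma α * Real.Gamma (1 - α) ≠ 0 :=
    (mul_pos (Real.Gamma_pos_of_pos hα0) (Real.Gamma_pos_of_pos (by linarith))).ne'
  have e : 1 - α - 1 = -α := by ring
  set μ : Measure ℝ := volume.restrict (Ioc 0 t) with hμ
  -- The product kernel, cut off to the triangle `s < x`, so that Fubini runs over a full square;
  -- its `x`-integral is the Beta constant for every `s`.
  set K : ℝ × ℝ → ℝ := {p : ℝ × ℝ | p.2 < p.1}.indicator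
    (fun p => (t - p.1) ^ (α - 1) * (p.1 - p.2) ^ (-α)) with hK
  have hKm : Measurable K := by
    refine Measurable.indicator (by fun_prop) (measurableSet_lt measurable_snd measurable_fst)
  have hgi : Integrable g μ := (intervalIntegrable_iff_integrableOn_Ioc_of_le ht).1 hg
  have hKs : ∀ s, (fun x => K (x, s)) =
      (Ioi s).indicator (fun x => (t - x) ^ (α - 1) * (x - s) ^ (-α)) := by
    intro s; ext x; by_cases h : s < x <;> simp [hK, h]
  have hres : ∀ s ∈ Ioc 0 t, μ.restrict (Ioi s) = volume.restrict (Ioc s t) := by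
    intro s hs
    rw [hμ, Measure.restrict_restrict measurableSet_Ioi]
    congr 1
    ext x
    exact ⟨fun h => ⟨h.1, h.2.2⟩, fun h => ⟨h.1, hs.1.trans h.1, h.2⟩⟩
  have hKint : ∀ s ∈ Ioo 0 t, ∫ x, K (x, s) ∂μ = Real.Gamma α * Real.Gamma (1 - α) := by
    intro s hs
    rw [hKs, integral_indicator measurableSet_Ioi, hres s ⟨hs.1, hs.2.le⟩,
      ← intervalIntegral.integral_of_le hs.2.le, integral_abel_kernel hα0 hα1 hs.2]
  have hKi : ∀ s ∈ Ioo 0 t, Integrable (fun x => K (x, s)) μ := by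
    intro s hs
    -- A non-integrable function has integral 0 by convention, but this integral is the nonzero Beta
    -- constant.
    by_contra h
    exact hB ((hKint s hs).symm.trans (integral_undef h))
  have hKnn : ∀ x ∈ Ioc 0 t, ∀ s, 0 ≤ K (x, s) := by
    intro x hx s
    refine indicator_apply_nonneg fun h => ?_
    exact mul_nonneg (Real.rpow_nonneg (sub_nonneg.2 hx.2) _)
      (Real.rpow_nonneg (sub_nonneg.2 (le_of_lt h)) _)
  -- At `s = t` the triangle has an empty slice and the Beta identity fails; this is a null set.
  have hae : ∀ᵐ s ∂μ, s ∈ Ioo 0 t := by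
    have h1 : ∀ᵐ s ∂μ, s ∈ Ioc 0 t := ae_restrict_mem measurableSet_Ioc
    have h2 : ∀ᵐ s ∂μ, s ≠ t := ae_restrict_of_ae (by simp [ae_iff])
    filter_upwards [h1, h2] with s hs hst
    exact ⟨hs.1, lt_of_le_of_ne hs.2 hst⟩
  have hI : Integrable (fun p : ℝ × ℝ => K p • g p.2) (μ.prod μ) := by
    have hm : AEStronglyMeasurable (fun p : ℝ × ℝ => K p • g p.2) (μ.prod μ) :=
      hKm.aestronglyMeasurable.smul hgi.aestronglyMeasurable.comp_snd
    rw [integrable_prod_iff' hm]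
    constructor
    · filter_upwards [hae] with s hs
      exact (hKi s hs).smul_const _
    · refine (hgi.norm.const_mul (Real.Gamma α * Real.Gamma (1 - α))).congr ?_
      filter_upwards [hae] with s hs
      rw [← hKint s hs, ← integral_mul_const]
      refine setIntegral_congr_fun measurableSet_Ioc fun x hx => ?_
      simp only [norm_smul, Real.norm_of_nonneg (hKnn x hx s)]
  have hswap := integral_integral_swap (f := fun x s => K (x, s) • g s) hI
  have hR : ∫ s, ∫ x, K (x, s) • g s ∂μ ∂μ =
      (Real.Gamma α * Real.Gamma (1 - α)) • ∫ x in (0 : ℝ)..t, g x := by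
    rw [intervalIntegral.integral_of_le ht, ← integral_smul]
    refine integral_congr_ae ?_
    filter_upwards [hae] with s hs
    rw [integral_smul_const, hKint s hs]
  have hL : ∫ x, ∫ s, K (x, s) • g s ∂μ ∂μ = ∫ x in (0 : ℝ)..t, (t - x) ^ (α - 1) •
      ∫ s in (0 : ℝ)..x, (x - s) ^ (-α) • g s := by
    rw [intervalIntegral.integral_of_le ht]
    refine setIntegral_congr_fun measurableSet_Ioc fun x hx => ?_
    have e1 : (fun s => K (x, s) • g s) = (Iio x).indicator
        (fun s => (t - x) ^ (α - 1) • ((x - s) ^ (-α) • g s)) := by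
      ext s; by_cases h : s < x <;> simp [hK, h, mul_smul]
    rw [e1, integral_indicator measurableSet_Iio, integral_smul,
      intervalIntegral.integral_of_le hx.1.le, integral_Ioc_eq_integral_Ioo, hμ,
      Measure.restrict_restrict measurableSet_Iio]
    congr 3
    ext s
    exact ⟨fun h => ⟨h.2.1, h.1⟩, fun h => ⟨h.2, h.1, h.2.le.trans hx.2⟩⟩
  rw [hL, hR] at hswap
  simp only [rlIntegral, e]
  have e3 : ∀ x : ℝ, (t - x) ^ (α - 1) • (Real.Gamma (1 - α))⁻¹ •
      ∫ s in (0 : ℝ)..x, (x - s) ^ (-α) • g s = (Real.Gamma (1 - α))⁻¹ • (t - x) ^ (α - 1) •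
      ∫ s in (0 : ℝ)..x, (x - s) ^ (-α) • g s := fun x => smul_comm _ _ _
  simp only [e3]
  rw [intervalIntegral.integral_smul, hswap, smul_smul, smul_smul, ← mul_inv,
    inv_mul_cancel₀ hB, one_smul]

theorem intervalIntegrable_abel_kernel_smul {β t : ℝ} (hβ : 0 < β) (ht : 0 ≤ t) {g : ℝ → F}
    (hg : ContinuousOn g (Icc 0 t)) :
    IntervalIntegrable (fun x => (t - x) ^ (β - 1) • g x) volume 0 t := by
  have h1 : IntervalIntegrable (fun x : ℝ => x ^ (β - 1)) volume 0 t :=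
    intervalIntegral.intervalIntegrable_rpow' (by linarith)
  have h2 := (h1.comp_sub_left t).symm
  simp only [sub_zero, sub_self] at h2
  exact h2.smul_continuousOn (by rwa [uIcc_of_le ht])

theorem rlIntegral_congr {β t : ℝ} (ht : 0 ≤ t) {g k : ℝ → F} (h : EqOn g k (Icc 0 t)) :
    rlIntegral β g t = rlIntegral β k t := by
  simp only [rlIntegral]
  congr 1
  refine intervalIntegral.integral_congr fun x hx => ?_
  rw [uIcc_of_le ht] at hx
  simp only [h hx]

theorem rlIntegral_sub {β t : ℝ} (hβ : 0 < β) (ht : 0 ≤ t) {g k : ℝ → F}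
    (hg : ContinuousOn g (Icc 0 t)) (hk : ContinuousOn k (Icc 0 t)) :
    rlIntegral β (fun x => g x - k x) t = rlIntegral β g t - rlIntegral β k t := by
  simp only [rlIntegral, smul_sub]
  rw [intervalIntegral.integral_sub (intervalIntegrable_abel_kernel_smul hβ ht hg)
    (intervalIntegrable_abel_kernel_smul hβ ht hk), smul_sub]

theorem rlIntegral_clm [CompleteSpace F] [CompleteSpace G] {β t : ℝ} (hβ : 0 < β) (ht : 0 ≤ t)
    {g : ℝ → F} (hg : ContinuousOn g (Icc 0 t)) (L : F →L[ℝ] G) :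
    rlIntegral β (fun x => L (g x)) t = L (rlIntegral β g t) := by
  simp only [rlIntegral, map_smul]
  rw [← L.intervalIntegral_comp_comm (intervalIntegrable_abel_kernel_smul hβ ht hg)]
  simp only [map_smul]

/-- Rescaling to the unit interval. -/
theorem rlIntegral_eq_unit {β t : ℝ} (hβ : 0 < β) (ht : 0 ≤ t) (g : ℝ → F) :
    rlIntegral β g t = ((Real.Gamma β)⁻¹ * t ^ β) •
      ∫ s in (0 : ℝ)..1, (1 - s) ^ (β - 1) • g (t * s) := by
  rcases ht.eq_or_lt with rfl | ht
  · simp [rlIntegral, Real.zero_rpow hβ.ne']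
  have h := intervalIntegral.smul_integral_comp_mul_left (a := 0) (b := 1)
    (fun x => (t - x) ^ (β - 1) • g x) t
  simp only [mul_zero, mul_one] at h
  rw [rlIntegral, ← h, mul_smul]
  congr 1
  rw [← intervalIntegral.integral_smul, ← intervalIntegral.integral_smul]
  refine intervalIntegral.integral_congr fun s hs => ?_
  rw [uIcc_of_le zero_le_one] at hs
  have e1 : t - t * s = t * (1 - s) := by ring
  rw [e1, Real.mul_rpow ht.le (sub_nonneg.2 hs.2), smul_smul, smul_smul, ← mul_assoc]
  congr 2
  nth_rewrite 1 [← Real.rpow_one t]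
  rw [← Real.rpow_add ht]
  congr 1; ring

/-- On the unit interval the singular kernel no longer depends on `t`, so dominated convergence
applies with majorant `(1 - s)^(β - 1) * M`. Extending `g` by its end values keeps this bound for
all real `t`. -/
theorem continuousOn_rlIntegral {β T : ℝ} (hβ : 0 < β) (hT : 0 ≤ T) {g : ℝ → F}
    (hg : ContinuousOn g (Icc 0 T)) : ContinuousOn (rlIntegral β g) (Icc 0 T) := by
  obtain ⟨M, hM⟩ := isCompact_Icc.exists_bound_of_continuousOn hg
  set k : ℝ → F := IccExtend hT ((Icc 0 T).domRestrict g) with hk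
  have hkc : Continuous k := (continuousOn_iff_continuous_domRestrict.1 hg).Icc_extend'
  have hkg : ∀ x ∈ Icc 0 T, k x = g x := fun x hx => by
    rw [hk, IccExtend_of_mem _ _ hx, domRestrict_apply]
  have hkM : ∀ x, ‖k x‖ ≤ M := fun x => by
    rw [hk, IccExtend_apply]; exact hM _ (by simp [hT])
  have h1 : IntervalIntegrable (fun x : ℝ => (1 - x) ^ (β - 1) * M) volume 0 1 := by
    have := intervalIntegrable_abel_kernel_smul (F := ℝ) hβ zero_le_one
      (continuousOn_const (c := M))
    simpa using this
  have hc : Continuous fun t => ∫ s in (0 : ℝ)..1, (1 - s) ^ (β - 1) • k (t * s) := by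
    refine intervalIntegral.continuous_of_dominated_interval
      (bound := fun x : ℝ => (1 - x) ^ (β - 1) * M) (fun t => ?_) (fun t => ?_) h1 ?_
    · refine AEStronglyMeasurable.smul ?_ ?_
      · exact Measurable.aestronglyMeasurable (by fun_prop)
      · exact (hkc.comp (by fun_prop)).aestronglyMeasurable
    · refine Eventually.of_forall fun s hs => ?_
      rw [uIoc_of_le zero_le_one] at hs
      have h0 : 0 ≤ (1 - s) ^ (β - 1) := Real.rpow_nonneg (sub_nonneg.2 hs.2) _
      rw [norm_smul, Real.norm_of_nonneg h0]
      exact mul_le_mul_of_nonneg_left (hkM _) h0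
    · refine Eventually.of_forall fun s _ => ?_
      exact continuous_const.smul (hkc.comp (by fun_prop))
  have hc2 : Continuous fun t : ℝ => (Real.Gamma β)⁻¹ * t ^ β :=
    continuous_const.mul (Real.continuous_rpow_const hβ.le)
  refine (hc2.smul hc).continuousOn.congr fun t ht => ?_
  rw [rlIntegral_congr (k := k) ht.1 fun x hx => (hkg x ⟨hx.1, hx.2.trans ht.2⟩).symm,
    rlIntegral_eq_unit hβ ht.1]
  rfl

/-- Needed for the continuation argument, where a trajectory is known to lie in the tube only up to
some time `τ`. -/
theorem HasCaputoDeriv.mono {α T τ : ℝ} {u h : ℝ → F} (H : HasCaputoDeriv α T u h) (hτ : τ ≤ T) :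
    HasCaputoDeriv α τ u h :=
  ⟨H.1.mono (Icc_subset_Icc_right hτ), fun t ht =>
    (H.2 t ⟨ht.1, ht.2.trans hτ⟩).mono (Icc_subset_Icc_right hτ)⟩

theorem HasCaputoDeriv.sub {α T : ℝ} (hα1 : α < 1) {u v h k : ℝ → F}
    (hu : HasCaputoDeriv α T u h) (hv : HasCaputoDeriv α T v k) :
    HasCaputoDeriv α T (fun t => u t - v t) (fun t => h t - k t) := by
  refine ⟨hu.1.sub hv.1, fun t ht => ((hu.2 t ht).sub (hv.2 t ht)).congr_of_mem (fun s hs => ?_) ht⟩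
  have hs' : Icc 0 s ⊆ Icc 0 T := Icc_subset_Icc_right hs.2
  rw [Pi.sub_apply, ← rlIntegral_sub (g := fun x => u x - u 0) (k := fun x => v x - v 0)
    (by linarith) hs.1 ((hu.1.mono hs').sub continuousOn_const)
    ((hv.1.mono hs').sub continuousOn_const)]
  exact rlIntegral_congr hs.1 fun x _ => sub_sub_sub_comm _ _ _ _

/-- With `L` the evaluation at a vector, the operator equation for `Φ` becomes a vector equation
comparable with differences of trajectories. -/
theorem HasCaputoDeriv.clm [CompleteSpace F] [CompleteSpace G] {α T : ℝ} (hα1 : α < 1)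
    {u h : ℝ → F} (hu : HasCaputoDeriv α T u h) (L : F →L[ℝ] G) :
    HasCaputoDeriv α T (fun t => L (u t)) (fun t => L (h t)) := by
  refine ⟨L.continuous.comp_continuousOn hu.1, fun t ht =>
    (L.hasFDerivAt.comp_hasDerivWithinAt t (hu.2 t ht)).congr_of_mem (fun s hs => ?_) ht⟩
  have hs' : Icc 0 s ⊆ Icc 0 T := Icc_subset_Icc_right hs.2
  rw [Function.comp_apply, ← rlIntegral_clm (g := fun x => u x - u 0) (by linarith) hs.1
    ((hu.1.mono hs').sub continuousOn_const)]
  exact rlIntegral_congr hs.1 fun x _ => (map_sub L _ _).symm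

/-- Two functions, continuous on `[0,T]`, with the same primitive agree on `[0,T]`. -/
theorem eqOn_of_integral_eq [CompleteSpace F] {T : ℝ} {g k : ℝ → F}
    (hT : 0 < T) (hg : ContinuousOn g (Icc 0 T)) (hk : ContinuousOn k (Icc 0 T))
    (h : ∀ t ∈ Icc 0 T, ∫ x in (0 : ℝ)..t, g x = ∫ x in (0 : ℝ)..t, k x) :
    EqOn g k (Icc 0 T) := by
  have hd : ∀ {g : ℝ → F}, ContinuousOn g (Icc 0 T) → ∀ t ∈ Icc 0 T,
      HasDerivWithinAt (fun t => ∫ x in (0 : ℝ)..t, g x) (g t) (Icc 0 T) t := by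
    intro g hg t ht
    set k : ℝ → F := IccExtend hT.le ((Icc 0 T).domRestrict g) with hk
    have hkc : Continuous k := (continuousOn_iff_continuous_domRestrict.1 hg).Icc_extend'
    have hkg : ∀ x ∈ Icc 0 T, k x = g x := fun x hx => by
      rw [hk, IccExtend_of_mem _ _ hx, domRestrict_apply]
    rw [← hkg t ht]
    refine ((hkc.integral_hasStrictDerivAt 0 t).hasDerivAt.hasDerivWithinAt).congr_of_mem
      (fun s hs => intervalIntegral.integral_congr fun x hx => ?_) ht
    rw [uIcc_of_le hs.1] at hx
    exact (hkg x ⟨hx.1, hx.2.trans hs.2⟩).symm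
  intro t ht
  exact (uniqueDiffOn_Icc hT t ht).eq_deriv _ (hd hg t ht)
    ((hd hk t ht).congr_of_mem h ht)

/-- A function with a continuous Caputo derivative `h` satisfies the Volterra equation
`u = u(0) + I^α h`. -/
theorem HasCaputoDeriv.volterra [CompleteSpace F] {α T : ℝ} (hα0 : 0 < α) (hα1 : α < 1)
    {u h : ℝ → F} (hu : HasCaputoDeriv α T u h) (hh : ContinuousOn h (Icc 0 T)) {t : ℝ}
    (ht : t ∈ Icc 0 T) : u t = u 0 + rlIntegral α h t := by
  rcases (ht.1.trans ht.2).eq_or_lt with hT | hT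
  · obtain rfl : t = 0 := le_antisymm (hT ▸ ht.2) ht.1
    simp [rlIntegral_zero_right]
  have hprim : ∀ t ∈ Icc 0 T,
      rlIntegral (1 - α) (fun s => u s - u 0) t = ∫ x in (0 : ℝ)..t, h x := by
    intro t ht
    have hsub : Icc 0 t ⊆ Icc 0 T := Icc_subset_Icc_right ht.2
    rw [intervalIntegral.integral_eq_sub_of_hasDeriv_right_of_le ht.1
      (f := rlIntegral (1 - α) (fun s => u s - u 0))
      (fun s hs => ((hu.2 s (hsub hs)).continuousWithinAt).mono hsub)
      (fun s hs => ((hu.2 s (hsub (Ioo_subset_Icc_self hs))).hasDerivAt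
        (Icc_mem_nhds hs.1 (hs.2.trans_le ht.2))).hasDerivWithinAt)
      ((hh.mono hsub).intervalIntegrable_of_Icc ht.1), rlIntegral_zero_right, sub_zero]
  have huc : ContinuousOn (fun s => u s - u 0) (Icc 0 T) := hu.1.sub continuousOn_const
  -- Applying `I^α` to `hprim` gives `I^1 (u - u 0) = I^α I^1 h = I^1 I^α h`; equal primitives of
  -- continuous functions then give the claim.
  have key : EqOn (fun s => u s - u 0) (rlIntegral α h) (Icc 0 T) := by
    refine eqOn_of_integral_eq hT huc (continuousOn_rlIntegral hα0 hT.le hh) fun t ht => ?_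
    have hsub : Icc 0 t ⊆ Icc 0 T := Icc_subset_Icc_right ht.2
    rw [← rlIntegral_rlIntegral_compl hα0 hα1 ht.1 ((huc.mono hsub).intervalIntegrable_of_Icc ht.1),
      ← rlIntegral_integral hα0 ht.1 ((hh.mono hsub).intervalIntegrable_of_Icc ht.1)]
    exact rlIntegral_congr ht.1 fun x hx => hprim x (hsub hx)
  rw [← key ht]
  simp

end Vector

/-! ### Gronwall inequalities with singular kernel. -/

/-- A Gronwall inequality for the weakly singular kernel `(t - x)^(α - 1)`. -/
theorem exists_abel_gronwall {α : ℝ} (hα0 : 0 < α) (T : ℝ) {K : ℝ} (hK : 0 ≤ K) :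
    ∃ C, 0 < C ∧ ∀ (τ a : ℝ) (v : ℝ → ℝ), τ ≤ T → 0 ≤ a → ContinuousOn v (Icc 0 τ) →
      (∀ t ∈ Icc 0 τ, v t ≤ a + K * ∫ x in (0 : ℝ)..t, (t - x) ^ (α - 1) * v x) →
        ∀ t ∈ Icc 0 τ, v t ≤ C * a := by
  have hΓ := Real.Gamma_pos_of_pos hα0
  have hD : 0 < 2 * (K * Real.Gamma α) + 1 := by positivity
  -- Since `∫₀^∞ r^(α-1) e^(-λr) dr = λ^(-α) Γ(α)`, this weight makes the integral operator a
  -- contraction with factor at most 1/2.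
  set lam : ℝ := (2 * (K * Real.Gamma α) + 1) ^ (α⁻¹) with hlam
  have hlam0 : 0 < lam := Real.rpow_pos_of_pos hD _
  have hlamα : (1 / lam) ^ α = (2 * (K * Real.Gamma α) + 1)⁻¹ := by
    rw [one_div, Real.inv_rpow hlam0.le, hlam, ← Real.rpow_mul hD.le, inv_mul_cancel₀ hα0.ne',
      Real.rpow_one]
  refine ⟨2 * Real.exp (lam * T), by positivity, ?_⟩
  intro τ a v hτ ha hv hle t ht
  set w : ℝ → ℝ := fun t => Real.exp (-(lam * t)) * v t with hw
  have hwc : ContinuousOn w (Icc 0 τ) :=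
    (Continuous.continuousOn (by fun_prop)).mul hv
  -- At a maximum of the weighted function the inequality reads `w t₀ ≤ a + w t₀ / 2` when `w t₀ ≥
  -- 0`.
  obtain ⟨t₀, ht₀, hmax⟩ := isCompact_Icc.exists_isMaxOn ⟨t, ht⟩ hwc
  have hvw : ∀ x, v x = Real.exp (lam * x) * w x := fun x => by
    rw [hw]; simp only; rw [← mul_assoc, ← Real.exp_add]; simp
  have hM : w t₀ ≤ 2 * a := by
    rcases le_total (w t₀) 0 with hneg | hpos
    · linarith
    have hsub : Icc 0 t₀ ⊆ Icc 0 τ := Icc_subset_Icc_right ht₀.2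
    have hi1 : IntervalIntegrable (fun x => (t₀ - x) ^ (α - 1) * v x) volume 0 t₀ := by
      simpa using intervalIntegrable_abel_kernel_smul hα0 ht₀.1 (hv.mono hsub)
    have hi2 : IntervalIntegrable (fun x => (t₀ - x) ^ (α - 1) * Real.exp (-(lam * (t₀ - x))))
        volume 0 t₀ := by
      have := intervalIntegrable_abel_kernel_smul hα0 ht₀.1
        (g := fun x => Real.exp (-(lam * (t₀ - x)))) (Continuous.continuousOn (by fun_prop))
      simpa using this
    have hint : Real.exp (-(lam * t₀)) * ∫ x in (0 : ℝ)..t₀, (t₀ - x) ^ (α - 1) * v x ≤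
        w t₀ * ((1 / lam) ^ α * Real.Gamma α) := by
      calc Real.exp (-(lam * t₀)) * ∫ x in (0 : ℝ)..t₀, (t₀ - x) ^ (α - 1) * v x
          = ∫ x in (0 : ℝ)..t₀, Real.exp (-(lam * t₀)) * ((t₀ - x) ^ (α - 1) * v x) :=
            (intervalIntegral.integral_const_mul _ _).symm
        _ ≤ ∫ x in (0 : ℝ)..t₀,
            w t₀ * ((t₀ - x) ^ (α - 1) * Real.exp (-(lam * (t₀ - x)))) := by
            refine intervalIntegral.integral_mono_on ht₀.1 (hi1.const_mul _) (hi2.const_mul _)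
              fun x hx => ?_
            have e : Real.exp (-(lam * (t₀ - x))) = Real.exp (-(lam * t₀)) * Real.exp (lam * x) := by
              rw [← Real.exp_add]; congr 1; ring
            have h0 : 0 ≤ (t₀ - x) ^ (α - 1) := Real.rpow_nonneg (sub_nonneg.2 hx.2) _
            have hwx : w x ≤ w t₀ := hmax (hsub hx)
            rw [hvw x, e]
            have := mul_le_mul_of_nonneg_left hwx (mul_nonneg h0
              (mul_nonneg (Real.exp_pos (-(lam * t₀))).le (Real.exp_pos (lam * x)).le))
            linarith
        _ = w t₀ * ∫ x in (0 : ℝ)..t₀, (t₀ - x) ^ (α - 1) * Real.exp (-(lam * (t₀ - x))) :=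
            intervalIntegral.integral_const_mul _ _
        _ ≤ w t₀ * ((1 / lam) ^ α * Real.Gamma α) := by
            refine mul_le_mul_of_nonneg_left ?_ hpos
            rw [← Real.integral_rpow_mul_exp_neg_mul_Ioi hα0 hlam0]
            have := intervalIntegral.integral_comp_sub_left (a := 0) (b := t₀)
              (fun r : ℝ => r ^ (α - 1) * Real.exp (-(lam * r))) t₀
            rw [this, sub_self, sub_zero, intervalIntegral.integral_of_le ht₀.1]
            refine setIntegral_mono_set ?_ ?_ Ioc_subset_Ioi_self.eventuallyLE
            · by_contra h
              have h2 := Real.integral_rpow_mul_exp_neg_mul_Ioi hα0 hlam0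
              rw [integral_undef h] at h2
              have : 0 < (1 / lam) ^ α * Real.Gamma α := by positivity
              linarith
            · filter_upwards [ae_restrict_mem measurableSet_Ioi] with x hx
              have hx' : (0 : ℝ) < x := hx
              simp only [Pi.zero_apply]
              positivity
    have h1 := mul_le_mul_of_nonneg_left (hle t₀ ht₀) (Real.exp_pos (-(lam * t₀))).le
    have h2 : w t₀ ≤ a + K * (w t₀ * ((1 / lam) ^ α * Real.Gamma α)) := by
      have h3 : Real.exp (-(lam * t₀)) * a ≤ a :=
        mul_le_of_le_one_left ha (Real.exp_le_one_iff.2 (by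
          have := mul_nonneg hlam0.le ht₀.1; linarith))
      have h4 := mul_le_mul_of_nonneg_left hint hK
      have h5 : w t₀ = Real.exp (-(lam * t₀)) * v t₀ := rfl
      rw [← h5] at h1
      linarith
    have h6 : K * ((1 / lam) ^ α * Real.Gamma α) ≤ 1 / 2 := by
      rw [hlamα, ← mul_assoc, mul_comm K, mul_assoc, inv_mul_eq_div, div_le_iff₀ hD]
      linarith
    have h7 := mul_le_mul_of_nonneg_left h6 hpos
    linarith
  have hwt : w t ≤ 2 * a := (hmax ht).trans hM
  rw [hvw t]
  calc Real.exp (lam * t) * w t ≤ Real.exp (lam * t) * (2 * a) :=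
        mul_le_mul_of_nonneg_left hwt (Real.exp_pos _).le
    _ ≤ Real.exp (lam * T) * (2 * a) := by
        have : lam * t ≤ lam * T := mul_le_mul_of_nonneg_left (ht.2.trans hτ) hlam0.le
        gcongr
    _ = 2 * Real.exp (lam * T) * a := by ring

/-- A priori bound for Caputo differential inequalities. -/
theorem exists_caputo_gronwall {F : Type*} [NormedAddCommGroup F] [NormedSpace ℝ F]
    [CompleteSpace F] {α T L : ℝ} (hα0 : 0 < α) (hα1 : α < 1) (hT : 0 ≤ T) (hL : 0 ≤ L) :
    ∃ C, 0 < C ∧ ∀ (τ b : ℝ) (u h : ℝ → F), τ ≤ T → 0 ≤ b → HasCaputoDeriv α τ u h →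
      ContinuousOn h (Icc 0 τ) → (∀ t ∈ Icc 0 τ, ‖h t‖ ≤ L * ‖u t‖ + b) →
        ∀ t ∈ Icc 0 τ, ‖u t‖ ≤ C * (‖u 0‖ + b) := by
  have hΓ := Real.Gamma_pos_of_pos hα0
  obtain ⟨C, hC, H⟩ := exists_abel_gronwall hα0 T (K := (Real.Gamma α)⁻¹ * L) (by positivity)
  -- The value at `T` of `I^α` applied to the constant 1, hence `D * b` bounds the contribution of
  -- `b`.
  set D : ℝ := (Real.Gamma α)⁻¹ * (T ^ α / α) with hD
  have hD0 : 0 ≤ D := by positivity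
  refine ⟨C * (1 + D), by positivity, ?_⟩
  intro τ b u h hτ hb hu hh hle
  have hint : ∀ t : ℝ, ∫ x in (0 : ℝ)..t, (t - x) ^ (α - 1) = t ^ α / α := by
    intro t
    have := intervalIntegral.integral_comp_sub_left (a := 0) (b := t)
      (fun r : ℝ => r ^ (α - 1)) t
    rw [this, sub_self, sub_zero, integral_rpow (Or.inl (by linarith)), sub_add_cancel,
      Real.zero_rpow hα0.ne', sub_zero]
  have hmain := H τ (‖u 0‖ + D * b) (fun t => ‖u t‖) hτ (by positivity) hu.1.norm ?_
  · intro t ht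
    refine (hmain t ht).trans ?_
    rw [mul_assoc C]
    refine mul_le_mul_of_nonneg_left ?_ hC.le
    have := mul_nonneg hD0 (norm_nonneg (u 0))
    linarith
  · intro t ht
    have hsub : Icc 0 t ⊆ Icc 0 τ := Icc_subset_Icc_right ht.2
    have hi1 : IntervalIntegrable (fun x => (t - x) ^ (α - 1) * ‖u x‖) volume 0 t := by
      simpa using intervalIntegrable_abel_kernel_smul hα0 ht.1 (hu.1.norm.mono hsub)
    have hi2 : IntervalIntegrable (fun x => (t - x) ^ (α - 1)) volume 0 t := by
      simpa using intervalIntegrable_abel_kernel_smul hα0 ht.1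
        (continuousOn_const (c := (1 : ℝ)))
    have hb1 : ‖∫ x in (0 : ℝ)..t, (t - x) ^ (α - 1) • h x‖ ≤
        L * (∫ x in (0 : ℝ)..t, (t - x) ^ (α - 1) * ‖u x‖) + b * (t ^ α / α) := by
      rw [← hint t, ← intervalIntegral.integral_const_mul, ← intervalIntegral.integral_const_mul,
        ← intervalIntegral.integral_add (hi1.const_mul _) (hi2.const_mul _)]
      refine intervalIntegral.norm_integral_le_of_norm_le ht.1 ?_
        ((hi1.const_mul _).add (hi2.const_mul _))
      refine Eventually.of_forall fun x hx => ?_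
      have h0 : 0 ≤ (t - x) ^ (α - 1) := Real.rpow_nonneg (sub_nonneg.2 hx.2) _
      rw [norm_smul, Real.norm_of_nonneg h0]
      have := mul_le_mul_of_nonneg_left (hle x (hsub (Ioc_subset_Icc_self hx))) h0
      linarith
    have htT : t ^ α / α ≤ T ^ α / α := by
      have := Real.rpow_le_rpow ht.1 (ht.2.trans hτ) hα0.le
      gcongr
    have hb2 := hb1.trans (add_le_add_right (mul_le_mul_of_nonneg_left htT hb) _)
    rw [hu.volterra hα0 hα1 hh ht]
    refine (norm_add_le _ _).trans ?_
    rw [rlIntegral, norm_smul, Real.norm_of_nonneg (by positivity)]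
    have := mul_le_mul_of_nonneg_left hb2 (inv_nonneg.2 hΓ.le)
    rw [hD]
    linarith


/-! ### Newton's method with the sharp asymptotic constant. -/

section Newton

variable {E : Type*} [NormedAddCommGroup E] [NormedSpace ℝ E]

/-- First-order Taylor estimate for a function whose derivative is Lipschitz on a convex set. -/
theorem norm_sub_sub_le_of_lipschitzOn_deriv {g : E → E} {A : E → E →L[ℝ] E} {s : Set E} {K : ℝ}
    (hs : Convex ℝ s) (hg : ∀ x ∈ s, HasFDerivAt g (A x) x)
    (hA : ∀ x ∈ s, ∀ z ∈ s, ‖A x - A z‖ ≤ K * ‖x - z‖) {a b : E} (ha : a ∈ s) (hb : b ∈ s) :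
    ‖g b - g a - A a (b - a)‖ ≤ K / 2 * ‖b - a‖ ^ 2 := by
  set γ : ℝ → E := fun t => a + t • (b - a) with hγ
  have hγs : ∀ t ∈ Icc (0 : ℝ) 1, γ t ∈ s := fun t ht => hs.add_smul_sub_mem ha hb ht
  have hγd : ∀ t, HasDerivAt γ (b - a) t := fun t => by
    have := ((hasDerivAt_id t).smul_const (b - a)).const_add a
    rw [one_smul] at this
    exact this
  set ψ : ℝ → E := fun t => g (γ t) - g a - t • A a (b - a) with hψ
  have hψd : ∀ t ∈ Icc (0 : ℝ) 1, HasDerivAt ψ (A (γ t) (b - a) - A a (b - a)) t := by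
    intro t ht
    have h1 := (hg _ (hγs t ht)).comp_hasDerivAt t (hγd t)
    have h2 : HasDerivAt (fun t : ℝ => t • A a (b - a)) (A a (b - a)) t := by
      simpa using (hasDerivAt_id t).smul_const (A a (b - a))
    exact (h1.sub_const (g a)).sub h2
  -- Barrier for the remainder `ψ` along the segment: `‖ψ'(t)‖ ≤ K t ‖b - a‖²`, and integrating `t`
  -- yields the factor 1/2.
  have hB : ∀ t : ℝ, HasDerivAt (fun t : ℝ => K / 2 * ‖b - a‖ ^ 2 * t ^ 2)
      (K * ‖b - a‖ ^ 2 * t) t := fun t => by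
    have := (hasDerivAt_pow 2 t).const_mul (K / 2 * ‖b - a‖ ^ 2)
    refine this.congr_deriv ?_
    push_cast
    ring
  have key := image_norm_le_of_norm_deriv_right_le_deriv_boundary (f := ψ) (a := 0) (b := 1)
    (fun t ht => (hψd t ht).continuousAt.continuousWithinAt)
    (fun t ht => (hψd t (Ico_subset_Icc_self ht)).hasDerivWithinAt)
    (by simp [hψ, hγ]) hB (fun t ht => ?_) (right_mem_Icc.2 zero_le_one)
  · simpa [hψ, hγ] using key
  · have h1 := hA _ (hγs t (Ico_subset_Icc_self ht)) a ha
    have h2 : ‖γ t - a‖ = t * ‖b - a‖ := by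
      simp [hγ, norm_smul, abs_of_nonneg ht.1]
    rw [h2] at h1
    rw [← sub_apply]
    refine (ContinuousLinearMap.le_opNorm _ _).trans ?_
    refine (mul_le_mul_of_nonneg_right h1 (norm_nonneg _)).trans (le_of_eq ?_)
    ring

theorem isInvertible_of_det_ne_zero [FiniteDimensional ℝ E] {A : E →L[ℝ] E} (hA : A.det ≠ 0) :
    A.IsInvertible :=
  ⟨A.toContinuousLinearEquivOfDetNeZero hA, A.coe_toContinuousLinearEquivOfDetNeZero hA⟩

/-- For every constant exceeding the norm of the derivative of the Jacobian at the root, the error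
of Newton's method is eventually bounded quadratically with this constant. -/
theorem newton_error_bound [FiniteDimensional ℝ E] {g : E → E} {A : E → E →L[ℝ] E} {x₀ : E}
    {ρ : ℕ → E} (hg : ∀ᶠ x in 𝓝 x₀, HasFDerivAt g (A x) x) (hA : ContDiffAt ℝ 1 A x₀)
    (h0 : g x₀ = 0) (hdet : ∀ l, (A (ρ l)).det ≠ 0)
    (hstep : ∀ l, ρ (l + 1) = ρ l - (A (ρ l)).inverse (g (ρ l)))
    (hconv : Tendsto ρ atTop (𝓝 x₀)) {K : ℝ} (hK : ‖fderiv ℝ A x₀‖ < K) :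
    ∀ᶠ l in atTop, ‖x₀ - ρ (l + 1)‖ ≤ 1 / 2 * ‖(A (ρ l)).inverse‖ * K * ‖x₀ - ρ l‖ ^ 2 := by
  have hK0 : 0 ≤ K := (norm_nonneg (fderiv ℝ A x₀)).trans hK.le
  obtain ⟨s, hs, hLip⟩ := (hA.hasStrictFDerivAt one_ne_zero).exists_lipschitzOnWith_of_nnnorm_lt
    ⟨K, hK0⟩ hK
  obtain ⟨r, hr, hball⟩ := Metric.mem_nhds_iff.1 (inter_mem hs hg)
  have hLip' : ∀ x ∈ Metric.ball x₀ r, ∀ z ∈ Metric.ball x₀ r, ‖A x - A z‖ ≤ K * ‖x - z‖ :=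
    fun x hx z hz => lipschitzOnWith_iff_norm_sub_le.1 hLip (hball hx).1 (hball hz).1
  filter_upwards [hconv (Metric.ball_mem_nhds x₀ hr)] with l hl
  have hT := norm_sub_sub_le_of_lipschitzOn_deriv (convex_ball x₀ r) (fun x hx => (hball hx).2)
    hLip' hl (Metric.mem_ball_self hr)
  -- As `g x₀ = 0`, the new error is minus the inverse Jacobian applied to the Taylor remainder
  -- based at `ρ l`.
  have e : x₀ - ρ (l + 1) = -(A (ρ l)).inverse (g x₀ - g (ρ l) - A (ρ l) (x₀ - ρ l)) := by
    rw [hstep, h0, map_sub, (isInvertible_of_det_ne_zero (hdet l)).inverse_apply_self, zero_sub,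
      map_neg]
    abel
  rw [e, norm_neg]
  refine (ContinuousLinearMap.le_opNorm _ _).trans ?_
  refine (mul_le_mul_of_nonneg_left hT (norm_nonneg _)).trans (le_of_eq ?_)
  ring

/-- Quadratic convergence of Newton's method with the sharp asymptotic constant. -/
theorem newton_quadratic [FiniteDimensional ℝ E] {g : E → E} {A : E → E →L[ℝ] E} {x₀ : E}
    {ρ : ℕ → E} (hg : ∀ᶠ x in 𝓝 x₀, HasFDerivAt g (A x) x) (hA : ContDiffAt ℝ 1 A x₀)
    (h0 : g x₀ = 0) (hdet₀ : (A x₀).det ≠ 0) (hdet : ∀ l, (A (ρ l)).det ≠ 0)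
    (hstep : ∀ l, ρ (l + 1) = ρ l - (A (ρ l)).inverse (g (ρ l)))
    (hconv : Tendsto ρ atTop (𝓝 x₀)) :
    ((fun l => x₀ - ρ (l + 1)) =O[atTop] fun l => ‖x₀ - ρ l‖ ^ 2) ∧
      limsup (fun l => ‖x₀ - ρ (l + 1)‖ₑ / ‖x₀ - ρ l‖ₑ ^ 2) atTop ≤
        ENNReal.ofReal (1 / 2 * ‖(A x₀).inverse‖ * ‖fderiv ℝ A x₀‖) := by
  have := FiniteDimensional.complete ℝ E
  obtain ⟨Ae, hAe⟩ := isInvertible_of_det_ne_zero hdet₀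
  have hinv : Tendsto (fun l => ‖(A (ρ l)).inverse‖) atTop (𝓝 ‖(A x₀).inverse‖) := by
    have h1 : ContinuousAt (ContinuousLinearMap.inverse : (E →L[ℝ] E) → E →L[ℝ] E) (A x₀) := by
      rw [← hAe]
      exact (contDiffAt_map_inverse (n := 0) Ae).continuousAt
    exact ((h1.tendsto.comp hA.continuousAt.tendsto).comp hconv).norm
  have hbound := fun {K : ℝ} (hK : ‖fderiv ℝ A x₀‖ < K) =>
    newton_error_bound hg hA h0 hdet hstep hconv hK
  constructor
  · set K : ℝ := ‖fderiv ℝ A x₀‖ + 1 with hK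
    have hlt : ‖fderiv ℝ A x₀‖ < K := lt_add_one _
    have hK0 : 0 < K := by positivity
    refine IsBigO.of_bound (1 / 2 * (‖(A x₀).inverse‖ + 1) * K) ?_
    filter_upwards [hbound hlt, hinv.eventually_le_const (lt_add_one _)] with l h1 h2
    rw [norm_pow, norm_norm]
    refine h1.trans ?_
    gcongr
  · have hle : ∀ K : ℝ, ‖fderiv ℝ A x₀‖ < K →
        limsup (fun l => ‖x₀ - ρ (l + 1)‖ₑ / ‖x₀ - ρ l‖ₑ ^ 2) atTop ≤
          ENNReal.ofReal (1 / 2 * ‖(A x₀).inverse‖ * K) := by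
      intro K hK
      have hK0 : 0 ≤ K := (norm_nonneg (fderiv ℝ A x₀)).trans hK.le
      have hlim : Tendsto (fun l => ENNReal.ofReal (1 / 2 * ‖(A (ρ l)).inverse‖ * K)) atTop
          (𝓝 (ENNReal.ofReal (1 / 2 * ‖(A x₀).inverse‖ * K))) :=
        ENNReal.tendsto_ofReal ((hinv.const_mul _).mul_const _)
      rw [← hlim.limsup_eq]
      refine limsup_le_limsup ?_
      filter_upwards [hbound hK] with l hl
      -- This covers a zero denominator too: the product bound then forces the numerator to vanish,
      -- and `0 / 0 = 0`.
      refine ENNReal.div_le_of_le_mul ?_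
      rw [← ofReal_norm, ← ofReal_norm, ← ENNReal.ofReal_pow (norm_nonneg _),
        ← ENNReal.ofReal_mul (by positivity)]
      exact ENNReal.ofReal_le_ofReal hl
    have hcont : Tendsto (fun K : ℝ => ENNReal.ofReal (1 / 2 * ‖(A x₀).inverse‖ * K))
        (𝓝[>] ‖fderiv ℝ A x₀‖)
        (𝓝 (ENNReal.ofReal (1 / 2 * ‖(A x₀).inverse‖ * ‖fderiv ℝ A x₀‖))) :=
      (ENNReal.tendsto_ofReal (tendsto_id.const_mul _)).mono_left nhdsWithin_le_nhds
    exact ge_of_tendsto hcont (eventually_mem_nhdsWithin.mono fun K hK => hle K hK)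

end Newton

/-! ### Differentiability of the terminal value in the initial value. -/

section Flow

variable {E : Type*} [NormedAddCommGroup E]

/-- The closed tube of radius `r` about the graph of `u` over `[0,T]`. -/
def tube (T r : ℝ) (u : ℝ → E) : Set (ℝ × E) :=
  {p | p.1 ∈ Icc 0 T ∧ ‖p.2 - u p.1‖ ≤ r}

/-- The graph is compact, so an open set around it contains a closed thickening, and in the max
metric vertical distance controls the distance to the graph. -/
theorem exists_tube_subset {T : ℝ} {u : ℝ → E} (hu : ContinuousOn u (Icc 0 T)) {W : Set (ℝ × E)}
    (hW : IsOpen W) (huW : ∀ t ∈ Icc (0 : ℝ) T, (t, u t) ∈ W) : ∃ r, 0 < r ∧ tube T r u ⊆ W := by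
  have hc : IsCompact ((fun t => (t, u t)) '' Icc 0 T) :=
    isCompact_Icc.image_of_continuousOn (continuousOn_id.prodMk hu)
  obtain ⟨r, hr, hsub⟩ := hc.exists_cthickening_subset_open hW (image_subset_iff.2 huW)
  refine ⟨r, hr, fun p hp => hsub ?_⟩
  refine Metric.mem_cthickening_of_dist_le p (p.1, u p.1) r _ ⟨p.1, hp.1, rfl⟩ ?_
  rw [Prod.dist_eq, dist_self, dist_eq_norm]
  exact max_le hr.le hp.2

theorem continuousOn_graph {T r τ : ℝ} {u v : ℝ → E} {G : Type*} [TopologicalSpace G]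
    {k : ℝ × E → G}
    (hk : ContinuousOn k (tube T r u)) (hv : ContinuousOn v (Icc 0 τ))
    (hmem : ∀ t ∈ Icc 0 τ, (t, v t) ∈ tube T r u) : ContinuousOn (fun t => k (t, v t)) (Icc 0 τ) :=
  hk.comp (continuousOn_id.prodMk hv) hmem

variable [NormedSpace ℝ E]

/-- The tube is the image of `[0,T]` times a closed ball under the shear `(t, z) ↦ (t, u t + z)`. -/
theorem isCompact_tube [FiniteDimensional ℝ E] {T r : ℝ} {u : ℝ → E}
    (hu : ContinuousOn u (Icc 0 T)) : IsCompact (tube T r u) := by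
  have := FiniteDimensional.proper ℝ E
  have hc : ContinuousOn (fun p : ℝ × E => (p.1, u p.1 + p.2))
      (Icc (0 : ℝ) T ×ˢ Metric.closedBall (0 : E) r) :=
    continuousOn_fst.prodMk ((hu.comp continuousOn_fst fun p hp => hp.1).add continuousOn_snd)
  convert (isCompact_Icc.prod (isCompact_closedBall (0 : E) r)).image_of_continuousOn hc using 1
  ext ⟨t, x⟩
  constructor
  · rintro ⟨h1, h2⟩
    exact ⟨(t, x - u t), ⟨h1, by simpa using h2⟩, by simp⟩
  · rintro ⟨⟨t', z⟩, ⟨h1, h2⟩, h3⟩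
    simp only [Prod.mk.injEq] at h3
    obtain ⟨rfl, rfl⟩ := h3
    exact ⟨h1, by simpa using h2⟩

/-- The data used about the right-hand side `f` on a closed tube about a trajectory. -/
structure IsGoodTube (T : ℝ) (f : ℝ → E → E) (u : ℝ → E) (r L : ℝ) : Prop where
  continuousOn : ContinuousOn (fun p : ℝ × E => f p.1 p.2) (tube T r u)
  differentiableAt : ∀ p ∈ tube T r u, DifferentiableAt ℝ (f p.1) p.2
  continuousOn_fderiv : ContinuousOn (fun p : ℝ × E => fderiv ℝ (f p.1) p.2) (tube T r u)
  bound : ∀ p ∈ tube T r u, ‖fderiv ℝ (f p.1) p.2‖ ≤ L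

theorem IsC1NearTrajectory.exists_isGoodTube [FiniteDimensional ℝ E] {T : ℝ}
    {f : ℝ → E → E} {u : ℝ → E} (hf : IsC1NearTrajectory T f u) (hu : ContinuousOn u (Icc 0 T)) :
    ∃ r L, 0 < r ∧ 0 ≤ L ∧ IsGoodTube T f u r L := by
  obtain ⟨W, hW, huW, h1, h2, h3⟩ := hf
  obtain ⟨r, hr, hsub⟩ := exists_tube_subset hu hW huW
  have hsub' : tube T r u ⊆ W ∩ Icc (0 : ℝ) T ×ˢ univ := fun p hp => ⟨hsub hp, hp.1, trivial⟩
  obtain ⟨L, hL⟩ := (isCompact_tube (r := r) hu).exists_bound_of_continuousOn (h3.mono hsub')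
  exact ⟨r, max L 0, hr, le_max_right _ _, h1.mono hsub', fun p hp => h2 p (hsub' hp),
    h3.mono hsub', fun p hp => (hL p hp).trans (le_max_left _ _)⟩

variable {T r L : ℝ} {f : ℝ → E → E} {u : ℝ → E}

/-- Time slices of the tube are balls, hence convex, and the mean value inequality applies. -/
theorem IsGoodTube.lipschitz (H : IsGoodTube T f u r L) {t : ℝ} {x z : E} (hx : (t, x) ∈ tube T r u)
    (hz : (t, z) ∈ tube T r u) : ‖f t z - f t x‖ ≤ L * ‖z - x‖ := by
  have hmem : ∀ w ∈ Metric.closedBall (u t) r, (t, w) ∈ tube T r u := fun w hw =>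
    ⟨hx.1, by rwa [← dist_eq_norm]⟩
  refine (convex_closedBall (u t) r).norm_image_sub_le_of_norm_fderiv_le (𝕜 := ℝ)
    (fun w hw => H.differentiableAt _ (hmem w hw)) (fun w hw => H.bound _ (hmem w hw)) ?_ ?_
  · rw [Metric.mem_closedBall, dist_eq_norm]; exact hx.2
  · rw [Metric.mem_closedBall, dist_eq_norm]; exact hz.2

/-- The Jacobian is uniformly continuous on the compact tube, which makes `δ` independent of `t` and
`x`. -/
theorem IsGoodTube.exists_taylor [FiniteDimensional ℝ E] (H : IsGoodTube T f u r L)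
    (hu : ContinuousOn u (Icc 0 T)) {ε : ℝ} (hε : 0 < ε) : ∃ δ, 0 < δ ∧ ∀ (t : ℝ) (x z : E), (t, x) ∈ tube T r u → (t, z) ∈ tube T r u →
      ‖z - x‖ < δ → ‖f t z - f t x - fderiv ℝ (f t) x (z - x)‖ ≤ ε * ‖z - x‖ := by
  have huc := (isCompact_tube (r := r) hu).uniformContinuousOn_of_continuous H.continuousOn_fderiv
  obtain ⟨δ, hδ, hd⟩ := Metric.uniformContinuousOn_iff.1 huc ε hε
  refine ⟨δ, hδ, fun t x z hx hz hxz => ?_⟩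
  have hmem : ∀ w ∈ Metric.closedBall (u t) r ∩ Metric.ball x δ, (t, w) ∈ tube T r u := fun w hw =>
    ⟨hx.1, by rw [← dist_eq_norm]; exact hw.1⟩
  refine ((convex_closedBall (u t) r).inter (convex_ball x δ)).norm_image_sub_le_of_norm_fderiv_le'
    (𝕜 := ℝ) (fun w hw => H.differentiableAt _ (hmem w hw)) (fun w hw => ?_)
    ⟨?_, Metric.mem_ball_self hδ⟩ ⟨?_, ?_⟩
  · have := hd (t, w) (hmem w hw) (t, x) hx (by
      rw [Prod.dist_eq, dist_self]; exact max_lt hδ hw.2)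
    rw [dist_eq_norm] at this
    exact this.le
  · rw [Metric.mem_closedBall, dist_eq_norm]; exact hx.2
  · rw [Metric.mem_closedBall, dist_eq_norm]; exact hz.2
  · rwa [Metric.mem_ball, dist_eq_norm]

/-- Continuous dependence on the initial value of solutions that stay in the tube. -/
theorem IsGoodTube.norm_sub_le (H : IsGoodTube T f u r L) {α C : ℝ} (hα1 : α < 1)
    (hC : ∀ (τ b : ℝ) (u h : ℝ → E), τ ≤ T → 0 ≤ b → HasCaputoDeriv α τ u h →
      ContinuousOn h (Icc 0 τ) → (∀ t ∈ Icc 0 τ, ‖h t‖ ≤ L * ‖u t‖ + b) →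
        ∀ t ∈ Icc 0 τ, ‖u t‖ ≤ C * (‖u 0‖ + b))
    {τ : ℝ} (hτ : τ ≤ T) {ξ ζ : E} {v w : ℝ → E} (hv : IsIVPSolution α T f ξ v)
    (hw : IsIVPSolution α T f ζ w) (hvt : ∀ t ∈ Icc 0 τ, (t, v t) ∈ tube T r u)
    (hwt : ∀ t ∈ Icc 0 τ, (t, w t) ∈ tube T r u) :
    ∀ t ∈ Icc 0 τ, ‖v t - w t‖ ≤ C * ‖ξ - ζ‖ := by
  have hv' := hv.2.mono hτ
  have hw' := hw.2.mono hτ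
  have := hC τ 0 _ _ hτ le_rfl (hv'.sub hα1 hw')
    ((continuousOn_graph H.continuousOn hv'.1 hvt).sub
      (continuousOn_graph H.continuousOn hw'.1 hwt))
    (fun t ht => by simpa using H.lipschitz (hwt t ht) (hvt t ht))
  simpa [hv.1, hw.1] using this

/-- A continuous function that starts below `r`, and stays below `r` as long as it is at most `r`,
stays below `r` forever. -/
theorem lt_of_continuation {d : ℝ → ℝ} (hd : ContinuousOn d (Icc 0 T)) (h0 : d 0 < r)
    (hcont : ∀ τ ∈ Icc 0 T, (∀ t ∈ Icc 0 τ, d t ≤ r) → d τ < r) : ∀ t ∈ Icc 0 T, d t < r := by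
  by_contra! hcon
  obtain ⟨t₁, ht₁, hdt₁⟩ := hcon
  have hivt : ∀ s ∈ Icc 0 T, r ≤ d s → ∃ x ∈ Icc 0 s, d x = r := fun s hs hrs =>
    intermediate_value_Icc hs.1 (hd.mono (Icc_subset_Icc_right hs.2)) ⟨h0.le, hrs⟩
  have hSc : IsCompact (Icc 0 T ∩ d ⁻¹' {r}) :=
    isCompact_Icc.of_isClosed_subset (hd.preimage_isClosed_of_isClosed isClosed_Icc
      isClosed_singleton) inter_subset_left
  obtain ⟨x, hx, hxr⟩ := hivt t₁ ht₁ hdt₁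
  -- The first time at which `d` equals `r`; by the intermediate value theorem `d ≤ r` before it, so
  -- `hcont` contradicts `d τ = r`.
  obtain ⟨τ, ⟨hτ, hdτ⟩, hmin⟩ := hSc.exists_isLeast ⟨x, ⟨hx.1, hx.2.trans ht₁.2⟩, hxr⟩
  refine (hcont τ hτ fun s hs => ?_).ne hdτ
  by_contra! hlt
  obtain ⟨z, hz, hzr⟩ := hivt s ⟨hs.1, hs.2.trans hτ.2⟩ hlt.le
  have hτz : τ ≤ z := hmin ⟨⟨hz.1, hz.2.trans (hs.2.trans hτ.2)⟩, hzr⟩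
  obtain rfl : z = s := le_antisymm hz.2 (hs.2.trans hτz)
  exact hlt.ne' hzr

/-- The terminal value `y(T, ξ)` is differentiable with respect to `ξ`, and its derivative is the
solution `Φ(T, ξ)` of the variational problem. -/
theorem eventually_hasFDerivAt_terminal [FiniteDimensional ℝ E] {α : ℝ} (hα0 : 0 < α) (hα1 : α < 1)
    (hT : 0 < T) {ρs : E} {y : ℝ → E → E} {Φ : ℝ → E → E →L[ℝ] E}
    (hy : ∀ᶠ ξ in 𝓝 ρs, IsIVPSolution α T f ξ (fun t => y t ξ))
    (hΦ : ∀ᶠ ξ in 𝓝 ρs, IsVariationalSolution α T f (fun t => y t ξ) (fun t => Φ t ξ))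
    (hf : IsC1NearTrajectory T f (fun t => y t ρs)) :
    ∀ᶠ ξ in 𝓝 ρs, HasFDerivAt (y T) (Φ T ξ) ξ := by
  have := FiniteDimensional.complete ℝ E
  have hys := hy.self_of_nhds
  obtain ⟨r, L, hr, hL, H⟩ := hf.exists_isGoodTube hys.2.1
  obtain ⟨C, hC0, hC⟩ := exists_caputo_gronwall (F := E) hα0 hα1 hT.le hL
  set N : Set E := {ξ | IsIVPSolution α T f ξ (fun t => y t ξ) ∧
    ∀ t ∈ Icc 0 T, (t, y t ξ) ∈ tube T r (fun t => y t ρs)} with hN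
  have hNmem : ∀ᶠ ξ in 𝓝 ρs, ξ ∈ N := by
    have hlim : Tendsto (fun ξ => ‖ξ - ρs‖) (𝓝 ρs) (𝓝 0) := tendsto_norm_sub_self ρs
    -- While the trajectory is in the tube, Gronwall bounds its distance to the centre by `C * ‖ξ -
    -- ρs‖`; being below `r`, it closes the continuation argument.
    have h1 : ∀ᶠ ξ in 𝓝 ρs, C * ‖ξ - ρs‖ < r := by
      have := hlim.const_mul C
      rw [mul_zero] at this
      exact this.eventually_lt_const hr
    filter_upwards [hy, h1, hlim.eventually_lt_const hr] with ξ hξ hξC hξr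
    refine ⟨hξ, fun t ht => ⟨ht, (lt_of_continuation (hξ.2.1.sub hys.2.1).norm ?_ ?_ t ht).le⟩⟩
    · have e1 : y 0 ξ = ξ := hξ.1
      have e2 : y 0 ρs = ρs := hys.1
      simpa only [Pi.sub_apply, e1, e2] using hξr
    · intro τ hτ hle
      exact (H.norm_sub_le hα1 hC hτ.2 hξ hys
        (fun t ht => ⟨⟨ht.1, ht.2.trans hτ.2⟩, hle t ht⟩)
        (fun t ht => ⟨⟨ht.1, ht.2.trans hτ.2⟩, by simpa using hr.le⟩) τ
        (right_mem_Icc.2 hτ.1)).trans_lt hξC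
  -- The derivative is needed at all `ξ` near `ρs`, so the trajectories from all `ζ` near `ξ` must
  -- stay in the tube as well.
  filter_upwards [hNmem.eventually_nhds, hΦ] with ξ hξN hΦξ
  obtain ⟨hξ, hξt⟩ := hξN.self_of_nhds
  rw [hasFDerivAt_iff_isLittleO, isLittleO_iff]
  intro c hc
  -- One factor `C` is lost in `‖y t ζ - y t ξ‖ ≤ C * ‖ζ - ξ‖`, the other in the Gronwall bound for
  -- the remainder.
  have hε : 0 < c / (C * C) := by positivity
  obtain ⟨δ, hδ, hTay⟩ := H.exists_taylor hys.2.1 hε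
  have hlim : ∀ᶠ ζ in 𝓝 ξ, C * ‖ζ - ξ‖ < δ := by
    have := (tendsto_norm_sub_self ξ).const_mul C
    rw [mul_zero] at this
    exact this.eventually_lt_const hδ
  filter_upwards [hξN, hlim] with ζ ⟨hζ, hζt⟩ hζδ
  have hdep := H.norm_sub_le hα1 hC le_rfl hζ hξ hζt hξt
  have hfd : ContinuousOn (fun t => fderiv ℝ (f t) (y t ξ)) (Icc 0 T) :=
    continuousOn_graph H.continuousOn_fderiv hξ.2.1 hξt
  have hev := hΦξ.2.2.clm hα1 (ContinuousLinearMap.apply ℝ E (ζ - ξ))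
  have hw := (hζ.2.sub hα1 hξ.2).sub hα1 hev
  have key := hC T (c / (C * C) * (C * ‖ζ - ξ‖)) _ _ le_rfl (by positivity) hw
    (((continuousOn_graph H.continuousOn hζ.2.1 hζt).sub
      (continuousOn_graph H.continuousOn hξ.2.1 hξt)).sub
      ((hfd.clm_comp hΦξ.2.2.1).clm_apply continuousOn_const)) (fun t ht => ?_) T
      (right_mem_Icc.2 hT.le)
  · have e1 : y 0 ζ = ζ := hζ.1
    have e2 : y 0 ξ = ξ := hξ.1
    have e3 : Φ 0 ξ = ContinuousLinearMap.id ℝ E := hΦξ.2.1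
    simp only [ContinuousLinearMap.apply_apply, e1, e2, e3, ContinuousLinearMap.id_apply, sub_self,
      norm_zero, zero_add] at key
    refine key.trans (le_of_eq ?_)
    field_simp
  · simp only [ContinuousLinearMap.apply_apply, ContinuousLinearMap.comp_apply]
    have h1 := (hTay t _ _ (hξt t ht) (hζt t ht) ((hdep t ht).trans_lt hζδ)).trans
      (mul_le_mul_of_nonneg_left (hdep t ht) hε.le)
    have h2 := (ContinuousLinearMap.le_opNorm (fderiv ℝ (f t) (y t ξ))
      (y t ζ - y t ξ - Φ t ξ (ζ - ξ))).trans
      (mul_le_mul_of_nonneg_right (H.bound _ (hξt t ht)) (norm_nonneg _))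
    -- The Caputo derivative of the remainder is the Jacobian applied to the remainder, plus the
    -- Taylor error of `f`: the terms `L * ‖u t‖` and `b` of Gronwall.
    have e : f t (y t ζ) - f t (y t ξ) - fderiv ℝ (f t) (y t ξ) (Φ t ξ (ζ - ξ)) =
        fderiv ℝ (f t) (y t ξ) (y t ζ - y t ξ - Φ t ξ (ζ - ξ)) +
        (f t (y t ζ) - f t (y t ξ) - fderiv ℝ (f t) (y t ξ) (y t ζ - y t ξ)) := by
      rw [map_sub (fderiv ℝ (f t) (y t ξ)) (y t ζ - y t ξ)]; abel
    rw [e]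
    exact (norm_add_le _ _).trans (add_le_add h2 h1)

end Flow

end FracShooting

/-! ### The main theorem. -/

/-- Quadratic convergence of the shooting-Newton procedure.  The space `E` is `ℝ^m` with an
arbitrary norm. -/
theorem theorem3 {E : Type*} [NormedAddCommGroup E] [NormedSpace ℝ E] [FiniteDimensional ℝ E]
    (α T : ℝ) (hα0 : 0 < α) (hα1 : α < 1) (hT : 0 < T)
    (f : ℝ → E → E) (η ρs : E) (y : ℝ → E → E) (Φ : ℝ → E → E →L[ℝ] E) (ρ : ℕ → E)
    (hy : ∀ᶠ ξ in 𝓝 ρs, FracShooting.IsIVPSolution α T f ξ (fun t => y t ξ))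
    (hΦ : ∀ᶠ ξ in 𝓝 ρs,
      FracShooting.IsVariationalSolution α T f (fun t => y t ξ) (fun t => Φ t ξ))
    (hf : FracShooting.IsC1NearTrajectory T f (fun t => y t ρs))
    (hη : y T ρs = η)
    (hdet : (Φ T ρs).det ≠ 0)
    (hC1 : ContDiffAt ℝ 1 (Φ T) ρs)
    (hρ : FracShooting.IsShootingNewton α T f η y Φ ρ)
    (hconv : Tendsto ρ atTop (𝓝 ρs)) :
    ((fun l => ρs - ρ (l + 1)) =O[atTop] fun l => ‖ρs - ρ l‖ ^ 2) ∧
      limsup (fun l => ‖ρs - ρ (l + 1)‖ₑ / ‖ρs - ρ l‖ₑ ^ 2) atTop ≤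
        ENNReal.ofReal (1 / 2 * ‖(Φ T ρs).inverse‖ * ‖fderiv ℝ (Φ T) ρs‖) := by
  refine FracShooting.newton_quadratic (g := fun ξ => y T ξ - η) (A := Φ T) ?_ hC1
    (by simp [hη]) hdet hρ.det_ne_zero hρ.step hconv
  filter_upwards [FracShooting.eventually_hasFDerivAt_terminal hα0 hα1 hT hy hΦ hf] with ξ hξ
  exact hξ.sub_const η
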